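/- For metric spaces $I,R$, a function $f:I\to R$, reals $k,\varepsilon\ge 0$ and $\delta\in[0,\infty]$, say that $f$ satisfies $P_{k,\varepsilon,\delta}$ if $d_R(f(i),f(i'))\le k\,d_I(i,i')+\varepsilon$ for all $i,i'\in I$ with $d_I(i,i')\le\delta$. Fix a precision $e>0$ and an initial angle $\sigma_0\ge\pi/2$ (for instance $\sigma_0=\pi/2$). The CORDIC program, executed in real arithmetic on an input $\beta\in I=[0,\pi/2]$, starts with $\theta=0$, $(x,y)=(1,0)$, $\sigma=\sigma_0$. While the stopping condition $S(\beta,\theta):\ |\theta-\beta|\le e$ fails, it replaces $\sigma$ by $|\sigma|/2$ if $\theta<\beta$ and by $-|\sigma|/2$ otherwise, then replaces $\theta$ by $\theta+\sigma$ and $(x,y)$ by $(x\cos\sigma-y\sin\sigma,\ x\sin\sigma+y\cos\sigma)$. It returns $foo(\beta)=(x,y)$; the computed cosine is $x$. Let $A=\mathbb R$ (values of $\theta$) with the usual distance, $B=\mathbb R^2$ (values of $(x,y)$) with the Euclidean distance, and $C=\mathbb R$ (values of $\sigma$). For a list $l$ of reals and $i\in I$, let $foo_b(l,i)$ and $foo_a(l)$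 be the final values of $(x,y)$ and of $\theta$ when the successive values of $\sigma$ are read from $l$; let $listFoo(i)$ be the list of values of $\sigma$ assigned in the run on input $i$, $foo_B(i,i')=foo_b(listFoo(i),i')$ and $foo_A(i)=foo_a(listFoo(i))$. Then the program terminates on every $\beta\in[0,\pi/2]$, and with $\delta=\infty$, $k_{N^*}=\varepsilon_{N^*}=0$, $k_A=1$, $\varepsilon_2=0$, $k_s=1$, $\varepsilon_s=0$, $\varepsilon_t=2e$ the following hold. * (C1) For every list $l$ of reals, $z\mapsto foo_b(l,z)$ satisfies $P_{k_{N^*},\varepsilon_{N^*},\infty}$. * (C2) For all $i_1,i\in I$: $d_B(foo_B(i,i),foo_B(i_1,i))\le k_A\,d_A(foo_A(i_1),foo_A(i))+\varepsilon_2$. * (C3) For all $a\in A$ and $i,i'\in I$ with $S(i',a)$ there is $a'\in A$ with $d_A(a,a')\le k_s\,d_I(i',i)+\varepsilon_s$ and $S(i,a')$. * (C4) For all $a,a'\in A$ and $i\in I$, if $S(i,a)$ and $S(i,a')$ then $d_A(a,a')\le\varepsilon_t$. Consequently the function $\beta\mapsto foo(\beta)=(x,y)$ satisfies $P_{k,\varepsilon,\infty}$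 with $k=k_{N^*}+k_Ak_s=1$ and $\varepsilon=\varepsilon_{N^*}+k_A(\varepsilon_s+\varepsilon_t)+\varepsilon_2=2e$, and so does the computed cosine $\beta\mapsto x$. Moreover the computed cosine differs from $\cos\beta$ by at most $e$. -/

import Mathlib

open scoped NNReal ENNReal

noncomputable section

/-- The robustness property `P_{k,ε,δ}` of a function between metric spaces
(`δ = ⊤` means that there is no restriction on the distance of the inputs). -/
def Robust {I R : Type*} [MetricSpace I] [MetricSpace R]
    (k ε : ℝ≥0) (δ : ℝ≥0∞) (f : I → R) : Prop :=
  ∀ i i' : I, edist i i' ≤ δ → dist (f i) (f i') ≤ k * dist i i' + ε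

/-- The looping program
`a = a0; b = b0; c = c0; while (!S(i,a)) { c = O(a,b,c,i); a = M(a,c); b = N(i,b,c); } return b;`
-/
structure LoopProgram (I A B C : Type*) where
  a0 : A
  b0 : B
  c0 : C
  /-- the stopping condition -/
  S : I → A → Prop
  O : A → B → C → I → C
  M : A → C → A
  N : I → B → C → B

namespace LoopProgram

variable {I A B C : Type*} (P : LoopProgram I A B C)

/-- One execution of the loop body on input `i`; the state is `(a, b, c)`. -/
def body (i : I) (s : A × B × C) : A × B × C :=
  let c := P.O s.1 s.2.1 s.2.2 i
  (P.M s.1 c, P.N i s.2.1 c, c)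

/-- The state after `n` executions of the loop body on input `i`. -/
def state (i : I) (n : ℕ) : A × B × C := (P.body i)^[n] (P.a0, P.b0, P.c0)

/-- The program terminates on input `i`. -/
def Terminates (i : I) : Prop := ∃ n, P.S i (P.state i n).1

/-- The number of executions of the loop body on input `i`: the first `n` at which the stopping
condition holds (meaningful only if the program terminates on `i`). -/
def steps (i : I) : ℕ := sInf {n | P.S i (P.state i n).1}

/-- The value returned on input `i` (meaningful only if the program terminates on `i`). -/
def foo (i : I) : B := (P.state i (P.steps i)).2.1

/-- The list of the successive values assigned to `c` in the execution on input `i`. -/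
def listFoo (i : I) : List C :=
  (List.range (P.steps i)).map fun j => (P.state i (j + 1)).2.2

/-- The value of `b` when the values of `c` are read from the list `l`. -/
def foob (l : List C) (i : I) : B := l.foldl (P.N i) P.b0

/-- The value of `a` when the values of `c` are read from the list `l`. -/
def fooa (l : List C) : A := l.foldl P.M P.a0

def fooB (i i' : I) : B := P.foob (P.listFoo i) i'

def fooA (i : I) : A := P.fooa (P.listFoo i)

variable [MetricSpace I] [MetricSpace A] [MetricSpace B]

def C1 (kN εN : ℝ≥0) (δ : ℝ≥0∞) : Prop :=
  ∀ l : List C, Robust kN εN δ fun z => P.foob l z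

def C2 (kA ε2 : ℝ≥0) (δ : ℝ≥0∞) : Prop :=
  ∀ i₁ i : I, edist i i₁ ≤ δ →
    dist (P.fooB i i) (P.fooB i₁ i) ≤ kA * dist (P.fooA i₁) (P.fooA i) + ε2

def C3 (ks εs : ℝ≥0) (δ : ℝ≥0∞) : Prop :=
  ∀ (a : A) (i i' : I), edist i i' ≤ δ → P.S i' a →
    ∃ a' : A, dist a a' ≤ ks * dist i' i + εs ∧ P.S i a'

def C4 (εt : ℝ≥0) : Prop :=
  ∀ (a a' : A) (i : I), P.S i a → P.S i a' → dist a a' ≤ εt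

end LoopProgram

/-- The CORDIC program, in real arithmetic, with precision `e` and initial value `σ₀` of `sigma`:
input `beta ∈ [0, π/2]`, `A = {theta}`, `B = {x, y}` with the Euclidean distance, `C = {sigma}`.
In each round `sigma` is halved in absolute value and given the sign that turns `theta` towards
`beta`; then `theta` is increased by `sigma` and `(x, y)` is rotated by the angle `sigma`. -/
def cordic (σ₀ : ℝ) (e : ℝ≥0) :
    LoopProgram (Set.Icc (0 : ℝ) (Real.pi / 2)) ℝ (EuclideanSpace ℝ (Fin 2)) ℝ where
  a0 := 0
  b0 := !₂[1, 0]
  c0 := σ₀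
  S beta theta := |theta - beta| ≤ e
  O theta _ sigma beta := if theta < beta then |sigma| / 2 else -(|sigma| / 2)
  M theta sigma := theta + sigma
  N _ b sigma :=
    !₂[Real.cos sigma * b 0 - Real.sin sigma * b 1, Real.sin sigma * b 0 + Real.cos sigma * b 1]

/-- The cosine computed by the CORDIC program: the final value of `x`. -/
def cordicCos (σ₀ : ℝ) (e : ℝ≥0) (beta : Set.Icc (0 : ℝ) (Real.pi / 2)) : ℝ :=
  (cordic σ₀ e).foo beta 0

end

/-! To compare the runs on `i` and `i'`, replay on `i` the values of `c` recorded on `i'`. By `C1`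
this hybrid is close to `foo i'`; by `C2` it is as close to `foo i` as the two final values of `a`
are to each other, and `C3` with `C4` bounds that distance. This is `robust_foo`.

For CORDIC, `(x, y)` is always `(cos θ, sin θ)`, whatever the input. So `C1` is trivial, `C2` says
that a chord is at most its arc, and `C3`, `C4` are facts about intervals of radius `e`. Termination
follows from the invariant `|θ - β| ≤ |σ|`, as `|σ|` halves each round. -/

namespace LoopProgram

variable {I A B C : Type*} (P : LoopProgram I A B C)

theorem state_succ (i : I) (n : ℕ) : P.state i (n + 1) = P.body i (P.state i n) :=
  Function.iterate_succ_apply' _ _ _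

/-- Replaying the first `n` values of `c` recovers the first component of the state. -/
theorem foldl_M_range (i : I) (n : ℕ) :
    ((List.range n).map fun j => (P.state i (j + 1)).2.2).foldl P.M P.a0 = (P.state i n).1 := by
  induction n with
  | zero => rfl
  | succ n ih =>
    rw [List.range_succ, List.map_append, List.foldl_append, ih]
    simp [state_succ, body]

/-- Replaying the first `n` values of `c` recovers the second component of the state. -/
theorem foldl_N_range (i : I) (n : ℕ) :
    ((List.range n).map fun j => (P.state i (j + 1)).2.2).foldl (P.N i) P.b0 =
      (P.state i n).2.1 := by
  induction n with
  | zero => rfl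
  | succ n ih =>
    rw [List.range_succ, List.map_append, List.foldl_append, ih]
    simp [state_succ, body]

theorem fooB_self (i : I) : P.fooB i i = P.foo i := P.foldl_N_range i _

variable {P} in
theorem Terminates.stop_fooA {i : I} (h : P.Terminates i) : P.S i (P.fooA i) := by
  -- Termination makes the set nonempty, so its infimum is attained rather than being the default 0.
  have hS : P.S i (P.state i (P.steps i)).1 := Nat.sInf_mem (s := {n | P.S i (P.state i n).1}) h
  rwa [← P.foldl_M_range] at hS

/-- The conditions `C1`–`C4` imply that a terminating looping program is robust. -/
theorem robust_foo [MetricSpace I] [MetricSpace A] [MetricSpace B]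
    {kN εN kA ε2 ks εs εt : ℝ≥0} {δ : ℝ≥0∞} (hT : ∀ i, P.Terminates i)
    (h1 : P.C1 kN εN δ) (h2 : P.C2 kA ε2 δ) (h3 : P.C3 ks εs δ) (h4 : P.C4 εt) :
    Robust (kN + kA * ks) (εN + kA * (εs + εt) + ε2) δ P.foo := by
  intro i i' hδ
  -- `a'` is accepted on `i`, so `C4` can compare it with `fooA i`.
  obtain ⟨a', ha', hS⟩ := h3 (P.fooA i') i i' hδ (hT i').stop_fooA
  have hA : dist (P.fooA i') (P.fooA i) ≤ ks * dist i i' + εs + εt := by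
    rw [dist_comm i i']
    exact (dist_triangle _ a' _).trans (add_le_add ha' (h4 _ _ i hS (hT i).stop_fooA))
  have hB : dist (P.fooB i' i) (P.fooB i' i') ≤ kN * dist i i' + εN :=
    h1 (P.listFoo i') i i' hδ
  have hkA := mul_le_mul_of_nonneg_left hA kA.coe_nonneg
  have htri := dist_triangle (P.fooB i i) (P.fooB i' i) (P.fooB i' i')
  have hC := h2 i' i hδ
  rw [P.fooB_self i, P.fooB_self i'] at htri
  rw [P.fooB_self i] at hC
  rw [P.fooB_self i'] at hB
  push_cast
  linarith

end LoopProgram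

/-- The chord between two points of the unit circle is at most the difference of the angles. -/
theorem dist_cos_sin_le (s t : ℝ) :
    dist (!₂[Real.cos s, Real.sin s] : EuclideanSpace ℝ (Fin 2)) !₂[Real.cos t, Real.sin t] ≤
      |s - t| := by
  rw [EuclideanSpace.dist_eq]
  refine Real.sqrt_le_iff.mpr ⟨abs_nonneg _, ?_⟩
  -- The squared chord is `2 - 2 * cos (s - t)`.
  have h := Real.one_sub_sq_div_two_le_cos (x := s - t)
  rw [Real.cos_sub] at h
  simp only [Fin.sum_univ_two, Real.dist_eq, sq_abs, Matrix.cons_val_zero, Matrix.cons_val_one]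
  linarith [Real.sin_sq_add_cos_sq s, Real.sin_sq_add_cos_sq t,
    sub_sq (Real.cos s) (Real.cos t), sub_sq (Real.sin s) (Real.sin t)]

/-- Rotating `(cos a, sin a)` successively by the angles in `l` yields the point at the angle
obtained by adding them up. -/
theorem cordic_foldl_N (σ₀ : ℝ) (e : ℝ≥0) (i : Set.Icc (0 : ℝ) (Real.pi / 2)) (l : List ℝ)
    (a : ℝ) : l.foldl ((cordic σ₀ e).N i) !₂[Real.cos a, Real.sin a] =
      !₂[Real.cos (l.foldl (cordic σ₀ e).M a), Real.sin (l.foldl (cordic σ₀ e).M a)] := by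
  induction l generalizing a with
  | nil => rfl
  | cons s l ih =>
    rw [List.foldl_cons, List.foldl_cons, ← ih]
    congr 1
    ext j
    fin_cases j
    · simp only [cordic, Real.cos_add]
      simp
      ring
    · simp only [cordic, Real.sin_add]
      simp
      ring

theorem cordic_foob (σ₀ : ℝ) (e : ℝ≥0) (l : List ℝ) (i : Set.Icc (0 : ℝ) (Real.pi / 2)) :
    (cordic σ₀ e).foob l i =
      !₂[Real.cos ((cordic σ₀ e).fooa l), Real.sin ((cordic σ₀ e).fooa l)] := by
  have h := cordic_foldl_N σ₀ e i l 0
  rwa [Real.cos_zero, Real.sin_zero] at h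

/-- After `n` rounds `|sigma|` is `σ₀ / 2 ^ n`, and it bounds the distance from `theta` to
`beta`. -/
theorem cordic_state_bound {σ₀ : ℝ} (hσ₀ : Real.pi / 2 ≤ σ₀) (e : ℝ≥0)
    (beta : Set.Icc (0 : ℝ) (Real.pi / 2)) (n : ℕ) :
    |((cordic σ₀ e).state beta n).2.2| = σ₀ / 2 ^ n ∧
      |((cordic σ₀ e).state beta n).1 - beta| ≤ σ₀ / 2 ^ n := by
  induction n with
  | zero =>
    have h0 : 0 ≤ σ₀ := Real.pi_div_two_pos.le.trans hσ₀
    obtain ⟨b, hb0, hb1⟩ := beta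
    -- The initial error is `β ≤ π / 2 ≤ σ₀`.
    simpa [LoopProgram.state, cordic, abs_of_nonneg h0, abs_of_nonneg hb0] using hb1.trans hσ₀
  | succ n ih =>
    obtain ⟨hs, ht⟩ := ih
    rw [LoopProgram.state_succ, pow_succ, ← div_div]
    generalize (cordic σ₀ e).state beta n = st at hs ht ⊢
    have h0 : 0 ≤ σ₀ / 2 ^ n := hs ▸ abs_nonneg _
    rw [abs_le] at ht
    simp only [LoopProgram.body, cordic, hs]
    -- With `r = σ₀ / 2 ^ n`, the error `θ - β` lies in `[-r, 0)` or `[0, r]`; a shift by `r / 2`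
    -- towards `β` puts it in `[-r / 2, r / 2]`.
    split_ifs with h
    · exact ⟨abs_of_nonneg (by linarith), abs_le.mpr ⟨by linarith, by linarith⟩⟩
    · rw [not_lt] at h
      exact ⟨by rw [abs_neg]; exact abs_of_nonneg (by linarith),
        abs_le.mpr ⟨by linarith, by linarith⟩⟩

theorem cordic_terminates {σ₀ : ℝ} (hσ₀ : Real.pi / 2 ≤ σ₀) {e : ℝ≥0} (he : 0 < e)
    (beta : Set.Icc (0 : ℝ) (Real.pi / 2)) : (cordic σ₀ e).Terminates beta := by
  have he' : (0 : ℝ) < e := he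
  obtain ⟨n, hn⟩ := pow_unbounded_of_one_lt (σ₀ / e) (one_lt_two : (1 : ℝ) < 2)
  refine ⟨n, (cordic_state_bound hσ₀ e beta n).2.trans ?_⟩
  rw [div_lt_iff₀ he'] at hn
  rw [div_le_iff₀ (by positivity)]
  linarith

theorem cordic_C1 (σ₀ : ℝ) (e : ℝ≥0) : (cordic σ₀ e).C1 0 0 ⊤ := by
  intro l i i' _
  simp [cordic_foob]

theorem cordic_C2 (σ₀ : ℝ) (e : ℝ≥0) : (cordic σ₀ e).C2 1 0 ⊤ := by
  intro i₁ i _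
  rw [LoopProgram.fooB, LoopProgram.fooB, cordic_foob, cordic_foob,
    dist_comm (LoopProgram.fooA _ _), Real.dist_eq]
  simpa [LoopProgram.fooA] using
    dist_cos_sin_le ((cordic σ₀ e).fooA i) ((cordic σ₀ e).fooA i₁)

theorem cordic_C3 (σ₀ : ℝ) (e : ℝ≥0) : (cordic σ₀ e).C3 1 0 ⊤ := by
  intro a i i' _ hS
  -- Translating `a` along with the input keeps the error unchanged.
  refine ⟨a + (i - i'), ?_, ?_⟩
  · rw [Subtype.dist_eq, dist_comm (i' : ℝ)]
    simp [Real.dist_eq]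
  · change |a + ((i : ℝ) - i') - i| ≤ e
    rwa [show a + ((i : ℝ) - i') - i = a - i' by ring]

theorem cordic_C4 (σ₀ : ℝ) (e : ℝ≥0) : (cordic σ₀ e).C4 (2 * e) := by
  intro a a' i (h : |a - i| ≤ e) (h' : |a' - i| ≤ e)
  have := dist_triangle_right a a' (i : ℝ)
  rw [Real.dist_eq a i, Real.dist_eq a' i] at this
  push_cast
  linarith

theorem mainTheorem3 (σ₀ : ℝ) (hσ₀ : Real.pi / 2 ≤ σ₀) (e : ℝ≥0) (he : 0 < e) :
    (∀ beta, (cordic σ₀ e).Terminates beta) ∧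
    (cordic σ₀ e).C1 0 0 ⊤ ∧
    (cordic σ₀ e).C2 1 0 ⊤ ∧
    (cordic σ₀ e).C3 1 0 ⊤ ∧
    (cordic σ₀ e).C4 (2 * e) ∧
    Robust 1 (2 * e) ⊤ (cordic σ₀ e).foo ∧
    Robust 1 (2 * e) ⊤ (cordicCos σ₀ e) ∧
    (∀ beta, |cordicCos σ₀ e beta - Real.cos beta| ≤ e) := by
  have hT := cordic_terminates hσ₀ he
  have hR : Robust 1 (2 * e) ⊤ (cordic σ₀ e).foo := by
    simpa using (cordic σ₀ e).robust_foo hT (cordic_C1 σ₀ e) (cordic_C2 σ₀ e) (cordic_C3 σ₀ e)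
      (cordic_C4 σ₀ e)
  refine ⟨hT, cordic_C1 σ₀ e, cordic_C2 σ₀ e, cordic_C3 σ₀ e, cordic_C4 σ₀ e, hR, ?_, ?_⟩
  · intro i i' h
    refine le_trans ?_ (hR i i' h)
    rw [dist_eq_norm, dist_eq_norm]
    -- A coordinate is 1-Lipschitz for the Euclidean norm.
    exact PiLp.norm_apply_le ((cordic σ₀ e).foo i - (cordic σ₀ e).foo i') 0
  · intro beta
    have hS : |(cordic σ₀ e).fooA beta - beta| ≤ e := (hT beta).stop_fooA
    have hx : cordicCos σ₀ e beta = Real.cos ((cordic σ₀ e).fooA beta) := by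
      rw [cordicCos, ← LoopProgram.fooB_self, LoopProgram.fooB, cordic_foob]
      rfl
    rw [hx]
    exact (Real.abs_cos_sub_cos_le _ _).trans hS
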